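/- Let $G$ be a finite undirected graph without loops or multiple edges, with vertex set $X$ (the states). Fix $x_0\in X$ and $N\ge 0$. A path of length $N$ from $x_0$ is a sequence $\boldsymbol{x}=(x_0,x_1,\dots,x_N)$ of states such that $x_i$ and $x_{i+1}$ are adjacent in $G$ for $0\le i<N$. Its fluxes are $\varphi_{xy}[\boldsymbol{x}]=\#\{0\le i<N : x_{i+1}=x,\ x_i=y\}$ for $x,y\in X$. For an array $\varphi=(\varphi_{xy})_{x,y\in X}$ of non-negative integers let $\varepsilon[\varphi]$ be the number of paths $\boldsymbol{x}$ of length $N$ from $x_0$ with $\varphi_{xy}[\boldsymbol{x}]=\varphi_{xy}$ for all $x,y$. Put $\varphi^{\mathrm{in}}_x=\sum_y\varphi_{xy}$ and $\varphi^{\mathrm{out}}_x=\sum_y\varphi_{yx}$. (1) Let $x_N\in X$ be a state, and suppose that $\varphi_{xy}=0$ whenever $xy$ is not an edge of $G$, that $\sum_{x,y}\varphi_{xy}=N$, and that $\varphi$ is quasi-balanced with source $x_0$ and sink $x_N$, i.e. $\varphi^{\mathrm{in}}_x-\varphi^{\mathrm{out}}_x=\delta_{x,x_N}-\delta_{x,x_0}$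 for all $x\in X$ (the case $x_0=x_N$ is allowed). Then every path counted by $\varepsilon[\varphi]$ ends at $x_N$, and $$\varepsilon[\varphi]=\frac{E[\varphi]}{\prod_{x,y\in X}\varphi_{xy}!}=\det\Delta_{x_N}[\varphi]\;\frac{\prod_{x\in X_N}(\varphi^{\mathrm{out}}_x-1+\delta_{x,x_N})!}{\prod_{x,y\in X}\varphi_{xy}!}.$$ Here $E[\varphi]$ is the number of open Eulerian tours from $x_0$ to $x_N$, i.e. of sequences of arrows that form a walk from $x_0$ to $x_N$ and use each arrow exactly once, in the digraph that has $\varphi_{xy}$ distinguishable arrows from $y$ to $x$ for all $x,y\in X$; $X_N=\{x\in X:\varphi^{\mathrm{in}}_x+\varphi^{\mathrm{out}}_x>0\}$ is the set of visited states; and $\Delta_{x_N}[\varphi]$ is obtained from the digraph Laplacian $\Delta=(\Delta_{xy})_{x,y\in X_N}$, with $\Delta_{xy}=-\varphi_{xy}$ for $x\ne y$ and $\Delta_{xx}=\varphi^{\mathrm{out}}_x$, by deleting the row and the column of $x_N$ if $x_N\in X_N$ (and $\Delta_{x_N}[\varphi]=\Delta$ otherwise; the determinant of the empty matrix is $1$).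 (2) Let $\pi_{xy}$ be the transition probabilities, from $y$ to $x$, of a restless Markov chain on $G$: $\pi_{xy}>0$ if $xy$ is an edge of $G$, $\pi_{xy}=0$ otherwise (so $\pi_{xx}=0$), and $\sum_x\pi_{xy}=1$ for every $y$. Let $P[\varphi]=\sum_{\boldsymbol{x}}\prod_{i=0}^{N-1}\pi_{x_{i+1}x_i}$, the sum over the paths $\boldsymbol{x}$ of length $N$ from $x_0$ with fluxes $\varphi$, be the probability that the chain started at $x_0$ has fluxes $\varphi$ after $N$ steps. Then for every array $\varphi$ of non-negative integers $$P[\varphi]=\varepsilon[\varphi]\prod_{x,y\in X}\pi_{xy}^{\varphi_{xy}}=\varepsilon[\varphi]\exp\Big(\sum_{x,y\in X}\varphi_{xy}\ln\pi_{xy}\Big),$$ with the conventions $0^0=1$ and, in the last sum, that terms with $\pi_{xy}=0$ are omitted. -/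

import Mathlib

open Finset

namespace MarkovFlux

/-- Transition probabilities of a restless Markov chain on a finite loopless undirected graph `G`.
`π x y` is the probability of jumping from `y` to `x` in one unit of time. It is nonzero exactly
along the edges of `G`; in particular `π x x = 0`, the walker never rests. -/
structure IsRestlessChain {X : Type*} [Fintype X] (G : SimpleGraph X) (π : X → X → ℝ) : Prop where
  pos_of_adj : ∀ x y, G.Adj x y → 0 < π x y
  zero_of_not_adj : ∀ x y, ¬ G.Adj x y → π x y = 0
  sum_eq_one : ∀ y, ∑ x, π x y = 1

open Classical in
/-- The paths `(x 0, …, x N)` with `N` jumps along edges of `G` that depart from `x₀`. -/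
noncomputable def paths {X : Type*} [Fintype X] (G : SimpleGraph X) (N : ℕ) (x₀ : X) :
    Finset (Fin (N + 1) → X) :=
  {x | x 0 = x₀ ∧ ∀ i : Fin N, G.Adj (x i.castSucc) (x i.succ)}

/-- `flux x a b` is the number of transitions `a ← b` (from `b` to `a`) along the path `x`. -/
def flux {X : Type*} [DecidableEq X] {N : ℕ} (x : Fin (N + 1) → X) (a b : X) : ℕ :=
  ∑ i : Fin N, if x i.succ = a ∧ x i.castSucc = b then 1 else 0

open Classical in
/-- The paths from `x₀` whose fluxes are exactly `φ`. -/
noncomputable def fluxPaths {X : Type*} [Fintype X] [DecidableEq X] (G : SimpleGraph X) (N : ℕ)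
    (x₀ : X) (φ : X → X → ℕ) : Finset (Fin (N + 1) → X) :=
  {x ∈ paths G N x₀ | flux x = φ}

/-- The number `ε[φ]` of distinguishable paths from `x₀` with fluxes `φ`. -/
noncomputable def pathCount {X : Type*} [Fintype X] [DecidableEq X] (G : SimpleGraph X) (N : ℕ)
    (x₀ : X) (φ : X → X → ℕ) : ℕ :=
  (fluxPaths G N x₀ φ).card

/-- The probability of a path, given its initial state. -/
noncomputable def pathProb {X : Type*} (π : X → X → ℝ) {N : ℕ} (x : Fin (N + 1) → X) : ℝ :=
  ∏ i : Fin N, π (x i.succ) (x i.castSucc)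

/-- The probability `P[φ]` that the fluxes of the walker started at `x₀` are `φ` after `N` jumps. -/
noncomputable def fluxProb {X : Type*} [Fintype X] [DecidableEq X] (G : SimpleGraph X)
    (π : X → X → ℝ) (N : ℕ) (x₀ : X) (φ : X → X → ℕ) : ℝ :=
  ∑ x ∈ paths G N x₀, if flux x = φ then pathProb π x else 0

/-- Number of arrows into `x` in the digraph with `φ x y` arrows from `y` to `x`. -/
def influx {X : Type*} [Fintype X] (φ : X → X → ℕ) (x : X) : ℕ := ∑ y, φ x y

/-- Number of arrows out of `x` in the digraph with `φ x y` arrows from `y` to `x`. -/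
def outflux {X : Type*} [Fintype X] (φ : X → X → ℕ) (x : X) : ℕ := ∑ y, φ y x

/-- The digraph of `φ` is quasi-balanced with source `x₀` and sink `xN`
(balanced, if `x₀ = xN`). -/
def IsQuasiBalanced {X : Type*} [Fintype X] [DecidableEq X] (φ : X → X → ℕ) (x₀ xN : X) : Prop :=
  ∀ x, (influx φ x : ℤ) - (outflux φ x : ℤ) =
    (if x = xN then 1 else 0) - (if x = x₀ then 1 else 0)

/-- The states touched by the arrows of `φ`. -/
abbrev Visited {X : Type*} [Fintype X] (φ : X → X → ℕ) : Type _ :=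
  {x : X // 0 < influx φ x + outflux φ x}

/-- The digraph Laplacian on the visited states. -/
def laplacian {X : Type*} [Fintype X] [DecidableEq X] (φ : X → X → ℕ) :
    Matrix (Visited φ) (Visited φ) ℤ :=
  Matrix.of fun x y => if x = y then (outflux φ y.1 : ℤ) else -(φ x.1 y.1 : ℤ)

/-- The Laplacian with the row and the column of the state `r` removed. -/
def reducedLaplacian {X : Type*} [Fintype X] [DecidableEq X] (φ : X → X → ℕ) (r : X) :
    Matrix {x : Visited φ // x.1 ≠ r} {x : Visited φ // x.1 ≠ r} ℤ :=
  (laplacian φ).submatrix Subtype.val Subtype.val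

/-- The arrows of the digraph of `φ`, all distinct: `⟨(x, y), k⟩` is the `k`-th arrow from `y`
to `x`. -/
abbrev Arrow {X : Type*} (φ : X → X → ℕ) : Type _ := Σ p : X × X, Fin (φ p.1 p.2)

/-- The sequence of arrows `e` is an open Eulerian tour from `x₀` to `xN`: it uses every arrow
exactly once, and its arrows follow one another along a sequence of states `x` that starts at `x₀`
and ends at `xN`. -/
def IsEulerTour {X : Type*} (φ : X → X → ℕ) (x₀ xN : X) {N : ℕ} (e : Fin N → Arrow φ) : Prop :=
  Function.Bijective e ∧ ∃ x : Fin (N + 1) → X, x 0 = x₀ ∧ x (Fin.last N) = xN ∧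
    ∀ i : Fin N, (e i).1 = (x i.succ, x i.castSucc)

/-- The number `E[φ]` of open Eulerian tours from `x₀` to `xN`, for a digraph with `N` arrows. -/
noncomputable def tourCount {X : Type*} (φ : X → X → ℕ) (N : ℕ) (x₀ xN : X) : ℕ :=
  Nat.card {e : Fin N → Arrow φ // IsEulerTour φ x₀ xN e}

end MarkovFlux

/-!
The number of paths is computed by removing the first arrow of a path. If `ε` is the number of
paths and `W` the product of the factorials of the fluxes, then `ε * W` satisfies the recursion
`ε[φ] * W[φ] = ∑ y, φ y x₀ * ε[φ - (y ← x₀)] * W[φ - (y ← x₀)]` (`pathCount_succ` and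
`prod_factorial_removeArrow`), and the determinant times the product of factorials of the outgoing
fluxes satisfies the same recursion (`det_mul_prod_factorial_eq_sum`).

* If `x₀` is not the final state, removing an arrow `y ← x₀` changes only the column of `x₀` of the
  Laplacian, and by the vector `e x₀ - e y`. The column itself is `∑ y, φ y x₀ • (e x₀ - e y)`, so
  the sum over `y` of the determinants, with weights `φ y x₀`, is `outflux φ x₀ - 1` times the
  original determinant (`sum_mul_det_removeArrow`). If the outgoing flux is `1`, there is no arrow
  into `x₀`; its row is a unit vector, so its column is irrelevant and the determinant does not
  change (`det_removeArrow_of_outflux_eq_one`).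
* If `x₀` is the final state, its column is not part of the reduced Laplacian and the recursion
  is that of the factorial, unless no arrow leaves `x₀`. In that case `x₀` is
  not visited, no row or column is deleted, and the full Laplacian of a nonempty balanced digraph
  is singular (`det_rootedLaplacian_eq_zero`).

To keep the index set fixed during the induction, the reduced Laplacian is replaced by the matrix
`rootedLaplacian` on all states (`det_reducedLaplacian`).

An Eulerian tour is a path with fluxes `φ` together with a matching of its jumps with the arrows
of `φ`. The matchings of a given path form a torsor under the permutations of parallel arrows, hence
the factor `W` (`card_equiv_arrow`, `tourCount_eq`). The probability of a path depends on its fluxes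
only (`pathProb_eq_prod_pow_flux`).
-/

namespace MarkovFlux

/-! ### Fluxes of a path -/

theorem influx_flux {X : Type*} [Fintype X] [DecidableEq X] {N : ℕ} (x : Fin (N + 1) → X) (a : X) :
    influx (flux x) a = ∑ i : Fin N, if x i.succ = a then 1 else 0 := by
  unfold influx flux
  rw [sum_comm]
  refine sum_congr rfl fun i _ => ?_
  simp [ite_and]

theorem outflux_flux {X : Type*} [Fintype X] [DecidableEq X] {N : ℕ} (x : Fin (N + 1) → X)
    (a : X) :
    outflux (flux x) a = ∑ i : Fin N, if x i.castSucc = a then 1 else 0 := by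
  unfold outflux flux
  rw [sum_comm]
  refine sum_congr rfl fun i _ => ?_
  simp [ite_and]

theorem isQuasiBalanced_flux {X : Type*} [Fintype X] [DecidableEq X] {N : ℕ}
    (x : Fin (N + 1) → X) : IsQuasiBalanced (flux x) (x 0) (x (Fin.last N)) := by
  intro a
  have h := (Fin.sum_univ_succ fun i => if x i = a then (1 : ℤ) else 0).symm.trans
    (Fin.sum_univ_castSucc fun i => if x i = a then (1 : ℤ) else 0)
  rw [influx_flux, outflux_flux]
  push_cast
  simp only [eq_comm (a := a)]
  linarith

/-- The fluxes of a path and its initial state determine its final state. -/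
theorem IsQuasiBalanced.sink_unique {X : Type*} [Fintype X] [DecidableEq X] {φ : X → X → ℕ}
    {x₀ y z : X} (hy : IsQuasiBalanced φ x₀ y) (hz : IsQuasiBalanced φ x₀ z) : y = z := by
  have h := (hy y).symm.trans (hz y)
  by_contra hne
  simp [hne] at h

theorem mem_fluxPaths {X : Type*} [Fintype X] [DecidableEq X] {G : SimpleGraph X} {N : ℕ}
    {x₀ : X} {φ : X → X → ℕ} {x : Fin (N + 1) → X} :
    x ∈ fluxPaths G N x₀ φ ↔
      (x 0 = x₀ ∧ ∀ i : Fin N, G.Adj (x i.castSucc) (x i.succ)) ∧ flux x = φ := by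
  simp [fluxPaths, paths]

theorem last_eq_of_mem_fluxPaths {X : Type*} [Fintype X] [DecidableEq X] {G : SimpleGraph X}
    {N : ℕ} {x₀ xN : X} {φ : X → X → ℕ} (hb : IsQuasiBalanced φ x₀ xN) {x : Fin (N + 1) → X}
    (hx : x ∈ fluxPaths G N x₀ φ) : x (Fin.last N) = xN := by
  obtain ⟨⟨rfl, -⟩, rfl⟩ := mem_fluxPaths.1 hx
  exact (isQuasiBalanced_flux x).sink_unique hb

/-! ### The probability of given fluxes -/

theorem pathProb_eq_prod_pow_flux {X : Type*} [Fintype X] [DecidableEq X] (π : X → X → ℝ) {N : ℕ}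
    (x : Fin (N + 1) → X) : pathProb π x = ∏ a, ∏ b, π a b ^ flux x a b := by
  unfold pathProb flux
  simp only [← prod_pow_eq_pow_sum]
  have h (i : Fin N) : π (x i.succ) (x i.castSucc) =
      ∏ a, ∏ b, π a b ^ (if x i.succ = a ∧ x i.castSucc = b then 1 else 0) := by
    rw [prod_eq_single_of_mem (x i.succ) (mem_univ _), prod_eq_single_of_mem (x i.castSucc)
      (mem_univ _)]
    · simp
    · intro b _ hb
      simp [hb.symm]
    · intro a _ ha
      simp [ha.symm]
  rw [prod_congr rfl fun i _ => h i, prod_comm]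
  exact prod_congr rfl fun a _ => prod_comm

theorem fluxProb_eq {X : Type*} [Fintype X] [DecidableEq X] (G : SimpleGraph X) (π : X → X → ℝ)
    (N : ℕ) (x₀ : X) (φ : X → X → ℕ) :
    fluxProb G π N x₀ φ = (pathCount G N x₀ φ : ℝ) * ∏ x, ∏ y, π x y ^ φ x y := by
  have h : fluxProb G π N x₀ φ =
      ∑ x ∈ fluxPaths G N x₀ φ, ∏ x, ∏ y, π x y ^ φ x y := by
    unfold fluxProb fluxPaths
    rw [sum_filter]
    refine sum_congr rfl fun x _ => ?_
    by_cases hx : flux x = φ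
    · simp [hx, pathProb_eq_prod_pow_flux]
    · simp [hx]
  rw [h, sum_const, nsmul_eq_mul, pathCount]

theorem adj_of_flux_ne_zero {X : Type*} [Fintype X] [DecidableEq X] {G : SimpleGraph X} {N : ℕ}
    {x₀ : X} {φ : X → X → ℕ} {x : Fin (N + 1) → X} (hx : x ∈ fluxPaths G N x₀ φ) {a b : X}
    (h : φ a b ≠ 0) : G.Adj a b := by
  obtain ⟨⟨-, hadj⟩, rfl⟩ := mem_fluxPaths.1 hx
  obtain ⟨i, -, hi⟩ := exists_ne_zero_of_sum_ne_zero h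
  obtain ⟨rfl, rfl⟩ : x i.succ = a ∧ x i.castSucc = b := by
    by_contra hne
    simp [hne] at hi
  exact (hadj i).symm

theorem fluxProb_eq_exp {X : Type*} [Fintype X] [DecidableEq X] {G : SimpleGraph X}
    {π : X → X → ℝ} (hπ : IsRestlessChain G π) (N : ℕ) (x₀ : X) (φ : X → X → ℕ) :
    fluxProb G π N x₀ φ =
      (pathCount G N x₀ φ : ℝ) * Real.exp (∑ x, ∑ y, (φ x y : ℝ) * Real.log (π x y)) := by
  rw [fluxProb_eq]
  rcases (fluxPaths G N x₀ φ).eq_empty_or_nonempty with h | ⟨x, hx⟩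
  · simp [pathCount, h]
  · simp only [Real.exp_sum]
    congr 1
    refine prod_congr rfl fun a _ => prod_congr rfl fun b _ => ?_
    -- on non-edges `π a b = 0` and `Real.log` takes its junk value, but there the flux vanishes
    by_cases h : φ a b = 0
    · simp [h]
    · rw [Real.exp_nat_mul, Real.exp_log (hπ.pos_of_adj a b (adj_of_flux_ne_zero hx h))]

/-! ### Eulerian tours -/

/-- The arrows of `φ` can be matched with the jumps of a path with fluxes `φ`, and any two such
matchings differ by a permutation of parallel arrows. -/
theorem card_equiv_arrow {X : Type*} [Fintype X] [DecidableEq X] {N : ℕ} (x : Fin (N + 1) → X) :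
    Nat.card {e : Fin N ≃ Arrow (flux x) // ∀ i, (e i).1 = (x i.succ, x i.castSucc)} =
      ∏ a, ∏ b, (flux x a b).factorial := by
  let t : Fin N → X × X := fun i => (x i.succ, x i.castSucc)
  have hcard (p : X × X) : Fintype.card {i // t i = p} = flux x p.1 p.2 := by
    rw [Fintype.card_subtype, card_filter]
    exact sum_congr rfl fun i _ => by simp [t, Prod.ext_iff]
  let e₀ : Fin N ≃ Arrow (flux x) := (Equiv.sigmaFiberEquiv t).symm.trans
    (Equiv.sigmaCongrRight fun p => Fintype.equivFinOfCardEq (hcard p))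
  have he₀ (i : Fin N) : (e₀ i).1 = t i := rfl
  let F : {g : Equiv.Perm (Arrow (flux x)) // Sigma.fst ∘ g = Sigma.fst} ≃
      {e : Fin N ≃ Arrow (flux x) // ∀ i, (e i).1 = t i} :=
    { toFun g := ⟨e₀.trans g.1, fun i => (congrFun g.2 (e₀ i)).trans (he₀ i)⟩
      invFun e := ⟨e₀.symm.trans e.1, by
        funext a
        obtain ⟨i, rfl⟩ := e₀.surjective a
        simp [e.2, he₀]⟩
      left_inv g := Subtype.ext (Equiv.ext fun a => by simp)
      right_inv e := Subtype.ext (Equiv.ext fun i => by simp) }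
  rw [← Nat.card_congr F, Nat.card_eq_fintype_card, DomMulAct.stabilizer_card,
    Fintype.prod_prod_type]
  refine prod_congr rfl fun a _ => prod_congr rfl fun b _ => ?_
  congr 1
  rw [Fintype.card_congr (Equiv.sigmaSubtype (a, b)), Fintype.card_fin]

theorem flux_eq_of_bijective {X : Type*} [Fintype X] [DecidableEq X] {φ : X → X → ℕ} {N : ℕ}
    {x : Fin (N + 1) → X} {e : Fin N → Arrow φ} (he : Function.Bijective e)
    (hx : ∀ i, (e i).1 = (x i.succ, x i.castSucc)) : flux x = φ := by
  funext a b
  have h : flux x a b = ∑ c : Arrow φ, if c.1 = (a, b) then 1 else 0 := by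
    rw [← he.sum_comp]
    exact sum_congr rfl fun i _ => by simp [hx]
  rw [h, ← card_filter, ← Fintype.card_subtype,
    Fintype.card_congr (Equiv.sigmaSubtype (a, b)), Fintype.card_fin]

theorem tourCount_eq {X : Type*} [Fintype X] [DecidableEq X] (G : SimpleGraph X) (N : ℕ)
    (x₀ xN : X) (φ : X → X → ℕ) (hG : ∀ x y, φ x y ≠ 0 → G.Adj x y)
    (hb : IsQuasiBalanced φ x₀ xN) :
    tourCount φ N x₀ xN = pathCount G N x₀ φ * ∏ x, ∏ y, (φ x y).factorial := by
  let T := Σ x : fluxPaths G N x₀ φ,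
    {e : Fin N ≃ Arrow φ // ∀ i, (e i).1 = (x.1 i.succ, x.1 i.castSucc)}
  let f : T → {e : Fin N → Arrow φ // IsEulerTour φ x₀ xN e} := fun p =>
    ⟨p.2.1, p.2.1.bijective, p.1.1, (mem_fluxPaths.1 p.1.2).1.1,
      last_eq_of_mem_fluxPaths hb p.1.2, p.2.2⟩
  have hf : Function.Bijective f := by
    constructor
    · rintro ⟨⟨x, hx⟩, e, he⟩ ⟨⟨y, hy⟩, e', he'⟩ h
      obtain rfl : e = e' := Equiv.coe_fn_injective (congrArg Subtype.val h)
      obtain rfl : x = y := by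
        funext i
        refine Fin.cases ?_ (fun i => ?_) i
        · exact (mem_fluxPaths.1 hx).1.1.trans (mem_fluxPaths.1 hy).1.1.symm
        · exact congrArg Prod.fst ((he i).symm.trans (he' i))
      rfl
    · rintro ⟨e, he, x, h0, hN, hx⟩
      have hadj (i : Fin N) : G.Adj (x i.castSucc) (x i.succ) := by
        have h := Fin.pos (e i).2
        rw [hx i] at h
        exact (hG _ _ h.ne').symm
      exact ⟨⟨⟨x, mem_fluxPaths.2 ⟨⟨h0, hadj⟩, flux_eq_of_bijective he hx⟩⟩,
        Equiv.ofBijective e he, hx⟩, rfl⟩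
  have hfib (x : fluxPaths G N x₀ φ) :
      Nat.card {e : Fin N ≃ Arrow φ // ∀ i, (e i).1 = (x.1 i.succ, x.1 i.castSucc)} =
        ∏ x, ∏ y, (φ x y).factorial := by
    obtain ⟨x, hx⟩ := x
    obtain ⟨-, rfl⟩ := mem_fluxPaths.1 hx
    exact card_equiv_arrow x
  rw [tourCount, ← Nat.card_congr (Equiv.ofBijective f hf), Nat.card_sigma,
    sum_congr rfl fun x _ => hfib x, sum_const, card_univ, Fintype.card_coe, smul_eq_mul, pathCount]

/-! ### Removing the first arrow -/

/-- The digraph of `φ` with one arrow from `b` to `a` removed. It equals `φ` if there is none. -/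
def removeArrow {X : Type*} [DecidableEq X] (φ : X → X → ℕ) (a b : X) : X → X → ℕ :=
  fun x y => if x = a ∧ y = b then φ x y - 1 else φ x y

theorem removeArrow_add {X : Type*} [DecidableEq X] {φ : X → X → ℕ} {a b : X} (h : φ a b ≠ 0)
    (x y : X) : removeArrow φ a b x y + (if a = x ∧ b = y then 1 else 0) = φ x y := by
  unfold removeArrow
  by_cases hxy : x = a ∧ y = b
  · obtain ⟨rfl, rfl⟩ := hxy
    simp only [and_self, if_true]
    omega
  · rw [if_neg hxy, if_neg (by tauto), add_zero]

theorem outflux_removeArrow_add {X : Type*} [Fintype X] [DecidableEq X] {φ : X → X → ℕ} {a b : X}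
    (h : φ a b ≠ 0) (x : X) :
    outflux (removeArrow φ a b) x + (if b = x then 1 else 0) = outflux φ x := by
  unfold outflux
  rw [← sum_congr rfl fun y _ => removeArrow_add h y x, sum_add_distrib]
  simp [ite_and]

theorem influx_removeArrow_add {X : Type*} [Fintype X] [DecidableEq X] {φ : X → X → ℕ} {a b : X}
    (h : φ a b ≠ 0) (x : X) :
    influx (removeArrow φ a b) x + (if a = x then 1 else 0) = influx φ x := by
  unfold influx
  rw [← sum_congr rfl fun y _ => removeArrow_add h x y, sum_add_distrib]
  simp [ite_and]

theorem sum_removeArrow_add_one {X : Type*} [Fintype X] [DecidableEq X] {φ : X → X → ℕ} {a b : X}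
    (h : φ a b ≠ 0) : ∑ x, ∑ y, removeArrow φ a b x y + 1 = ∑ x, ∑ y, φ x y := by
  have h' := sum_congr (s₁ := univ) rfl fun x _ => (influx_removeArrow_add h x)
  rw [sum_add_distrib] at h'
  simp only [sum_ite_eq, mem_univ, if_true] at h'
  exact h'

theorem IsQuasiBalanced.removeArrow {X : Type*} [Fintype X] [DecidableEq X] {φ : X → X → ℕ}
    {x₀ xN y : X} (hb : IsQuasiBalanced φ x₀ xN) (h : φ y x₀ ≠ 0) :
    IsQuasiBalanced (removeArrow φ y x₀) y xN := by
  intro x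
  have h₁ := hb x
  rw [← influx_removeArrow_add h, ← outflux_removeArrow_add h] at h₁
  push_cast at h₁
  simp only [eq_comm (a := x)] at h₁ ⊢
  linarith

theorem prod_factorial_removeArrow {X : Type*} [Fintype X] [DecidableEq X] {φ : X → X → ℕ}
    {a b : X} (h : φ a b ≠ 0) :
    ∏ x, ∏ y, (φ x y).factorial = φ a b * ∏ x, ∏ y, (removeArrow φ a b x y).factorial := by
  have hf (x y : X) : (φ x y).factorial =
      (if a = x then if b = y then φ a b else 1 else 1) *
        (removeArrow φ a b x y).factorial := by
    by_cases hxy : a = x ∧ b = y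
    · obtain ⟨rfl, rfl⟩ := hxy
      simp [removeArrow, Nat.mul_factorial_pred h]
    · rw [← removeArrow_add h x y, if_neg hxy, add_zero, ← ite_and, if_neg hxy, one_mul]
  simp only [hf, prod_mul_distrib]
  simp [prod_ite_irrel]

theorem flux_eq_tail_add {X : Type*} [DecidableEq X] {N : ℕ} (x : Fin (N + 2) → X) (a b : X) :
    flux x a b = flux (Fin.tail x) a b + if x 1 = a ∧ x 0 = b then 1 else 0 := by
  unfold flux
  rw [Fin.sum_univ_succ, add_comm]
  rfl

theorem flux_tail {X : Type*} [DecidableEq X] {N : ℕ} (x : Fin (N + 2) → X) :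
    flux (Fin.tail x) = removeArrow (flux x) (x 1) (x 0) := by
  funext a b
  have h := flux_eq_tail_add x a b
  have h₁ : flux x (x 1) (x 0) ≠ 0 := by
    rw [flux_eq_tail_add]
    simp
  have h₂ := removeArrow_add h₁ a b
  omega

theorem tail_mem_fluxPaths {X : Type*} [Fintype X] [DecidableEq X] {G : SimpleGraph X} {N : ℕ}
    {x₀ : X} {φ : X → X → ℕ} {x : Fin (N + 2) → X} (hx : x ∈ fluxPaths G (N + 1) x₀ φ) :
    Fin.tail x ∈ fluxPaths G N (x 1) (removeArrow φ (x 1) x₀) := by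
  obtain ⟨⟨h0, hadj⟩, hφ⟩ := mem_fluxPaths.1 hx
  refine mem_fluxPaths.2 ⟨⟨rfl, fun i => hadj i.succ⟩, ?_⟩
  rw [flux_tail, hφ, h0]

theorem cons_mem_fluxPaths {X : Type*} [Fintype X] [DecidableEq X] {G : SimpleGraph X} {N : ℕ}
    {x₀ y : X} {φ : X → X → ℕ} (hG : G.Adj y x₀) (h : φ y x₀ ≠ 0) {z : Fin (N + 1) → X}
    (hz : z ∈ fluxPaths G N y (removeArrow φ y x₀)) :
    (Fin.cons x₀ z : Fin (N + 2) → X) ∈ fluxPaths G (N + 1) x₀ φ := by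
  obtain ⟨⟨rfl, hadj⟩, hz⟩ := mem_fluxPaths.1 hz
  refine mem_fluxPaths.2 ⟨⟨rfl, fun i => ?_⟩, ?_⟩
  · refine Fin.cases ?_ (fun i => ?_) i
    · exact hG.symm
    · exact hadj i
  · funext a b
    rw [flux_eq_tail_add, Fin.tail_cons, hz, Fin.cons_one, Fin.cons_zero]
    exact removeArrow_add h a b

/-- First-step decomposition of the number of paths. -/
theorem pathCount_succ {X : Type*} [Fintype X] [DecidableEq X] (G : SimpleGraph X) (N : ℕ)
    (x₀ : X) (φ : X → X → ℕ) (hG : ∀ x y, φ x y ≠ 0 → G.Adj x y) :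
    pathCount G (N + 1) x₀ φ =
      ∑ y, if φ y x₀ = 0 then 0 else pathCount G N y (removeArrow φ y x₀) := by
  unfold pathCount
  rw [card_eq_sum_card_fiberwise (f := fun x => x 1) (t := univ) fun _ _ => mem_univ _]
  refine sum_congr rfl fun y _ => ?_
  split_ifs with h
  · rw [card_eq_zero, filter_eq_empty_iff]
    rintro x hx rfl
    obtain ⟨⟨rfl, -⟩, rfl⟩ := mem_fluxPaths.1 hx
    rw [flux_eq_tail_add] at h
    simp at h
  · refine card_bij' (fun x _ => Fin.tail x) (fun z _ => Fin.cons x₀ z) ?_ ?_ ?_ ?_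
    · intro x hx
      obtain ⟨hx', hy⟩ := mem_filter.1 hx
      rw [← hy]
      exact tail_mem_fluxPaths hx'
    · intro z hz
      refine mem_filter.2 ⟨cons_mem_fluxPaths (hG _ _ h) h hz, ?_⟩
      rw [Fin.cons_one]
      exact (mem_fluxPaths.1 hz).1.1
    · intro x hx
      rw [← (mem_fluxPaths.1 (mem_filter.1 hx).1).1.1]
      exact Fin.cons_self_tail x
    · intro z _
      exact Fin.tail_cons _ _

/-! ### The Laplacian with unit columns -/

/-- The Laplacian on all of `X`, where the column of the root `r` and the columns of the states
without outgoing arrows are replaced by unit vectors. Its determinant is that of the reduced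
Laplacian, while its index set does not change when arrows are removed; and the column of `x`
depends only on the arrows out of `x`. -/
def rootedLaplacian {X : Type*} [Fintype X] [DecidableEq X] (φ : X → X → ℕ) (r : X) :
    Matrix X X ℤ :=
  Matrix.of fun x y =>
    if y = r ∨ outflux φ y = 0 then (if x = y then 1 else 0)
    else if x = y then (outflux φ y : ℤ) else -(φ x y : ℤ)

theorem rootedLaplacian_removeArrow {X : Type*} [Fintype X] [DecidableEq X] {φ : X → X → ℕ}
    {a b : X} (h : φ a b ≠ 0) (r : X) :
    rootedLaplacian (removeArrow φ a b) r =
      (rootedLaplacian φ r).updateCol b fun x => rootedLaplacian (removeArrow φ a b) r x b := by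
  ext x y
  rcases eq_or_ne y b with rfl | hy
  · simp
  · have h₁ := outflux_removeArrow_add h y
    rw [if_neg hy.symm, add_zero] at h₁
    simp [rootedLaplacian, h₁, removeArrow, hy]

theorem rootedLaplacian_removeArrow_root {X : Type*} [Fintype X] [DecidableEq X] {φ : X → X → ℕ}
    {a r : X} (h : φ a r ≠ 0) : rootedLaplacian (removeArrow φ a r) r = rootedLaplacian φ r := by
  rw [rootedLaplacian_removeArrow h]
  ext x y
  rcases eq_or_ne y r with rfl | hy
  · simp [rootedLaplacian]
  · simp [Matrix.updateCol_ne hy]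

/-- A nonempty balanced digraph that avoids the root has a singular Laplacian: the sum of the rows
of the visited states vanishes. -/
theorem det_rootedLaplacian_eq_zero {X : Type*} [Fintype X] [DecidableEq X] {φ : X → X → ℕ}
    {r : X} (hloop : ∀ x, φ x x = 0) (hb : IsQuasiBalanced φ r r) (hr : outflux φ r = 0)
    {z : X} (hz : outflux φ z ≠ 0) : (rootedLaplacian φ r).det = 0 := by
  rw [← Matrix.exists_vecMul_eq_zero_iff]
  refine ⟨fun x => if outflux φ x = 0 then 0 else 1, fun h => ?_, ?_⟩
  · simpa [hz] using congrFun h z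
  · funext y
    simp only [Matrix.vecMul, dotProduct, rootedLaplacian, Matrix.of_apply, Pi.zero_apply]
    by_cases hy : outflux φ y = 0
    · simp [hy]
    · have hyr : y ≠ r := fun h => hy (h ▸ hr)
      have hterm (x : X) : (if outflux φ x = 0 then (0 : ℤ) else 1) *
          (if y = r ∨ outflux φ y = 0 then (if x = y then 1 else 0)
            else if x = y then (outflux φ y : ℤ) else -(φ x y : ℤ)) =
          (if x = y then (outflux φ y : ℤ) else 0) - φ x y := by
        rcases eq_or_ne x y with rfl | hxy
        · simp [hy, hyr, hloop]
        · by_cases hx : outflux φ x = 0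
          · have h₁ : influx φ x = 0 := by
              have := hb x
              simp only [sub_self] at this
              omega
            have h₂ : φ x y = 0 := (sum_eq_zero_iff.1 h₁) y (mem_univ y)
            simp [hx, hxy, h₂]
          · simp [hx, hy, hyr, hxy]
      simp only [hterm, sum_sub_distrib]
      simp [outflux]

theorem outflux_source {X : Type*} [Fintype X] [DecidableEq X] {φ : X → X → ℕ}
    {x₀ xN : X} (hb : IsQuasiBalanced φ x₀ xN) (hne : x₀ ≠ xN) :
    outflux φ x₀ = influx φ x₀ + 1 := by
  have := hb x₀
  simp only [hne, if_false, if_true] at this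
  omega

/-- Multilinearity in the column of `x₀`: it is the combination, with coefficients `φ y x₀`, of the
vectors `e x₀ - e y`, and removing an arrow from `x₀` to `y` subtracts one such vector. -/
theorem sum_mul_det_removeArrow {X : Type*} [Fintype X] [DecidableEq X] {φ : X → X → ℕ}
    {x₀ r : X} (hloop : ∀ x, φ x x = 0) (hne : x₀ ≠ r) {k : ℕ} (hk : outflux φ x₀ = k + 2) :
    ∑ y, (φ y x₀ : ℤ) * (rootedLaplacian (removeArrow φ y x₀) r).det =
      (k + 1) * (rootedLaplacian φ r).det := by
  set M := rootedLaplacian φ r with hM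
  have hcol (x : X) : M x x₀ = (if x = x₀ then (k + 2 : ℤ) else 0) - φ x x₀ := by
    rcases eq_or_ne x x₀ with rfl | hx
    · simp [hM, rootedLaplacian, hne, hk, hloop]
    · simp [hM, rootedLaplacian, hne, hk, hx]
  have hterm (y : X) : (φ y x₀ : ℤ) * (rootedLaplacian (removeArrow φ y x₀) r).det =
      (φ y x₀ : ℤ) * M.cramer (fun x => M x x₀ - (if x = x₀ then 1 else 0) +
        (if x = y then 1 else 0)) x₀ := by
    by_cases hy : φ y x₀ = 0
    · simp [hy]
    · rw [rootedLaplacian_removeArrow hy, Matrix.cramer_apply]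
      congr 3
      funext x
      have hyx : y ≠ x₀ := fun h => hy (h ▸ hloop x₀)
      have ho := outflux_removeArrow_add hy x₀
      have ho' : outflux (removeArrow φ y x₀) x₀ = k + 1 := by
        simp only [if_true] at ho
        omega
      have hr := removeArrow_add hy x x₀
      rw [hcol, ← hr]
      rcases eq_or_ne x x₀ with rfl | hx
      · have : removeArrow φ y x x x = 0 := by simp [removeArrow, hloop]
        simp [rootedLaplacian, hne, ho', hyx, hyx.symm, this]
        ring
      · simp [rootedLaplacian, hne, ho', hx, eq_comm (a := x)]
  have hsum : (∑ y, (φ y x₀ : ℤ) • fun x => M x x₀ - (if x = x₀ then (1 : ℤ) else 0) +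
      (if x = y then 1 else 0)) = ((k : ℤ) + 1) • fun x => M x x₀ := by
    funext x
    have ho : ∑ y, (φ y x₀ : ℤ) = k + 2 := by exact_mod_cast hk
    simp only [Finset.sum_apply, Pi.smul_apply, smul_eq_mul, mul_add, sum_add_distrib, ← sum_mul,
      ho]
    rw [hcol]
    rcases eq_or_ne x x₀ with rfl | hx
    · simp [hloop]
      ring
    · simp [hx]
      ring
  have hlin := congrFun (congrArg M.cramer hsum) x₀
  rw [map_sum, map_smul] at hlin
  simp only [map_smul, Finset.sum_apply, Pi.smul_apply, smul_eq_mul] at hlin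
  rw [sum_congr rfl fun y _ => hterm y, hlin, Matrix.cramer_apply]
  congr 2
  ext i j
  rcases eq_or_ne j x₀ with rfl | hj
  · simp
  · simp [Matrix.updateCol_ne hj]

/-- If the source has a single outgoing arrow, it has no incoming ones, so that its row is a unit
vector and its column does not matter. -/
theorem det_removeArrow_of_outflux_eq_one {X : Type*} [Fintype X] [DecidableEq X]
    {φ : X → X → ℕ} {x₀ xN y : X} (hb : IsQuasiBalanced φ x₀ xN) (hne : x₀ ≠ xN)
    (ho : outflux φ x₀ = 1) (hy : φ y x₀ ≠ 0) :
    (rootedLaplacian (removeArrow φ y x₀) xN).det = (rootedLaplacian φ xN).det := by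
  set M := rootedLaplacian φ xN with hM
  have hin : influx φ x₀ = 0 := by
    have := outflux_source hb hne
    omega
  have hrow (z : X) : φ x₀ z = 0 := (sum_eq_zero_iff.1 hin) z (mem_univ z)
  have ho' : outflux (removeArrow φ y x₀) x₀ = 0 := by
    have := outflux_removeArrow_add hy x₀
    simp only [if_true] at this
    omega
  have hcol : (fun x => rootedLaplacian (removeArrow φ y x₀) xN x x₀) =
      fun x => if x = x₀ then 1 else 0 := by
    funext x
    simp [rootedLaplacian, ho']
  have hzero : M.cramer ((fun x => M x x₀) - fun x => if x = x₀ then 1 else 0) x₀ = 0 := by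
    rw [Matrix.cramer_apply]
    refine Matrix.det_eq_zero_of_row_eq_zero x₀ fun j => ?_
    rcases eq_or_ne j x₀ with rfl | hj
    · simp [hM, rootedLaplacian, hne, ho]
    · rw [Matrix.updateCol_ne hj]
      simp [hM, rootedLaplacian, hj.symm, hrow]
  rw [map_sub, Pi.sub_apply, sub_eq_zero, Matrix.cramer_apply, Matrix.cramer_apply] at hzero
  rw [rootedLaplacian_removeArrow hy, hcol, ← hM, ← hzero]
  congr 1
  ext i j
  rcases eq_or_ne j x₀ with rfl | hj
  · simp
  · simp [Matrix.updateCol_ne hj]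

/-- A state other than the sink is visited exactly if some arrow leaves it, so the columns outside
the reduced Laplacian are unit vectors and the matrix is block triangular. -/
theorem det_reducedLaplacian {X : Type*} [Fintype X] [DecidableEq X] {φ : X → X → ℕ}
    {x₀ xN : X} (hb : IsQuasiBalanced φ x₀ xN) :
    (reducedLaplacian φ xN).det = (rootedLaplacian φ xN).det := by
  have hp (x : X) : (0 < influx φ x + outflux φ x ∧ x ≠ xN) ↔ ¬(x = xN ∨ outflux φ x = 0) := by
    have := hb x
    by_cases hx : x = xN
    · simp [hx]
    · simp only [hx, if_false] at this
      simp only [hx, false_or, ne_eq, not_false_eq_true, and_true]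
      split_ifs at this <;> omega
  rw [Matrix.twoBlockTriangular_det' (rootedLaplacian φ xN)
    (fun x => 0 < influx φ x + outflux φ x ∧ x ≠ xN)]
  · have h₁ : Matrix.toSquareBlockProp (rootedLaplacian φ xN)
        (fun x => ¬(0 < influx φ x + outflux φ x ∧ x ≠ xN)) = 1 := by
      ext ⟨i, hi⟩ ⟨j, hj⟩
      rw [hp, not_not] at hj
      simp [Matrix.toSquareBlockProp, rootedLaplacian, hj, Matrix.one_apply]
    rw [h₁, Matrix.det_one, mul_one]
    let e : {x : Visited φ // x.1 ≠ xN} ≃ {x : X // 0 < influx φ x + outflux φ x ∧ x ≠ xN} :=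
      Equiv.subtypeSubtypeEquivSubtypeInter (fun x => 0 < influx φ x + outflux φ x) (· ≠ xN)
    rw [← Matrix.det_submatrix_equiv_self e]
    congr 1
    ext i j
    have hj := (hp j.1.1).1 ⟨j.1.2, j.2⟩
    simp [e, reducedLaplacian, laplacian, rootedLaplacian, Matrix.toSquareBlockProp, hj,
      Subtype.ext_iff]
  · intro i hi j hj
    have hij : i ≠ j := fun h => hj (h ▸ hi)
    rw [hp, not_not] at hj
    simp [rootedLaplacian, hj, hij]

/-! ### The number of paths -/

/-- The product of factorials over the states, where removing an arrow out of `x₀` changes only the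
factor of `x₀`. -/
theorem prod_factorial_outflux_removeArrow {X : Type*} [Fintype X] [DecidableEq X]
    {φ : X → X → ℕ} {x₀ y : X} (hy : φ y x₀ ≠ 0) (δ : X → ℕ) :
    ∏ x, (outflux (removeArrow φ y x₀) x + δ x - 1).factorial =
      (outflux φ x₀ - 1 + δ x₀ - 1).factorial *
        ∏ x ∈ univ.erase x₀, (outflux φ x + δ x - 1).factorial := by
  rw [← mul_prod_erase univ _ (mem_univ x₀)]
  have ho := outflux_removeArrow_add hy
  congr 1
  · have := ho x₀
    rw [if_pos rfl] at this
    rw [← this, Nat.add_sub_cancel]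
  · refine prod_congr rfl fun x hx => ?_
    rw [← ho x, if_neg (ne_of_mem_erase hx).symm, add_zero]

theorem pathCount_zero {X : Type*} [Fintype X] [DecidableEq X] (G : SimpleGraph X) (x₀ : X) :
    pathCount G 0 x₀ (fun _ _ => 0) = 1 := by
  rw [pathCount, card_eq_one]
  refine ⟨fun _ => x₀, ?_⟩
  ext x
  rw [mem_fluxPaths, mem_singleton]
  constructor
  · rintro ⟨⟨h, -⟩, -⟩
    funext i
    rw [← h, Fin.fin_one_eq_zero i]
  · rintro rfl
    refine ⟨⟨rfl, fun i => i.elim0⟩, ?_⟩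
    funext a b
    simp [flux]

/-- The right-hand side obeys the first-step recursion of the number of paths. -/
theorem det_mul_prod_factorial_eq_sum {X : Type*} [Fintype X] [DecidableEq X]
    {φ : X → X → ℕ} {x₀ xN z : X} (hloop : ∀ x, φ x x = 0) (hb : IsQuasiBalanced φ x₀ xN)
    (hz : outflux φ z ≠ 0) :
    (rootedLaplacian φ xN).det *
        ((∏ x, (outflux φ x + (if x = xN then 1 else 0) - 1).factorial : ℕ) : ℤ) =
      ∑ y, (φ y x₀ : ℤ) * ((rootedLaplacian (removeArrow φ y x₀) xN).det *
        ((∏ x, (outflux (removeArrow φ y x₀) x +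
          (if x = xN then 1 else 0) - 1).factorial : ℕ) : ℤ)) := by
  set c : ℕ := ∏ x ∈ univ.erase x₀, (outflux φ x + (if x = xN then 1 else 0) - 1).factorial
    with hc
  have hprod (y : X) : (φ y x₀ : ℤ) * ((rootedLaplacian (removeArrow φ y x₀) xN).det *
        ((∏ x, (outflux (removeArrow φ y x₀) x +
          (if x = xN then 1 else 0) - 1).factorial : ℕ) : ℤ)) =
      (φ y x₀ : ℤ) * (rootedLaplacian (removeArrow φ y x₀) xN).det *
        (((outflux φ x₀ - 1 + (if x₀ = xN then 1 else 0) - 1).factorial * c : ℕ) : ℤ) := by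
    by_cases hy : φ y x₀ = 0
    · simp [hy]
    · rw [prod_factorial_outflux_removeArrow hy (fun x => if x = xN then 1 else 0), mul_assoc]
  have hsum : ∑ y, (φ y x₀ : ℤ) = outflux φ x₀ := by simp [outflux]
  rw [sum_congr rfl fun y _ => hprod y, ← sum_mul, ← mul_prod_erase univ _ (mem_univ x₀), ← hc]
  by_cases hx : x₀ = xN
  · subst hx
    simp only [if_true]
    have hdet (y : X) : (φ y x₀ : ℤ) * (rootedLaplacian (removeArrow φ y x₀) x₀).det =
        (φ y x₀ : ℤ) * (rootedLaplacian φ x₀).det := by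
      by_cases hy : φ y x₀ = 0
      · simp [hy]
      · rw [rootedLaplacian_removeArrow_root hy]
    rw [sum_congr rfl fun y _ => hdet y, ← sum_mul, hsum]
    rcases hk : outflux φ x₀ with _ | k
    · simp [det_rootedLaplacian_eq_zero hloop hb hk hz]
    · simp only [Nat.add_sub_cancel, Nat.factorial_succ]
      push_cast
      ring
  · simp only [hx, if_false, add_zero]
    rcases hk : outflux φ x₀ with _ | _ | k
    · have := outflux_source hb hx
      omega
    · have hdet (y : X) : (φ y x₀ : ℤ) * (rootedLaplacian (removeArrow φ y x₀) xN).det =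
          (φ y x₀ : ℤ) * (rootedLaplacian φ xN).det := by
        by_cases hy : φ y x₀ = 0
        · simp [hy]
        · rw [det_removeArrow_of_outflux_eq_one hb hx hk hy]
      rw [sum_congr rfl fun y _ => hdet y, ← sum_mul, hsum, hk]
      simp
    · rw [sum_mul_det_removeArrow hloop hx hk]
      simp only [Nat.add_sub_cancel, Nat.factorial_succ]
      push_cast
      ring

/-- The number of paths in terms of a determinant, by induction on the length; the final state `xN`
stays fixed while the source moves along the path. -/
theorem pathCount_mul_prod_factorial {X : Type*} [Fintype X] [DecidableEq X] (G : SimpleGraph X)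
    (N : ℕ) (xN : X) : ∀ (x₀ : X) (φ : X → X → ℕ), (∀ x y, φ x y ≠ 0 → G.Adj x y) →
      ∑ x, ∑ y, φ x y = N → IsQuasiBalanced φ x₀ xN →
      ((pathCount G N x₀ φ * ∏ x, ∏ y, (φ x y).factorial : ℕ) : ℤ) =
        (rootedLaplacian φ xN).det *
          ((∏ x, (outflux φ x + (if x = xN then 1 else 0) - 1).factorial : ℕ) : ℤ) := by
  induction N with
  | zero =>
    intro x₀ φ _ hN _
    obtain rfl : φ = fun _ _ => 0 := by
      funext x y
      exact sum_eq_zero_iff.1 (sum_eq_zero_iff.1 hN x (mem_univ x)) y (mem_univ y)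
    have hM : rootedLaplacian (fun _ _ : X => 0) xN = 1 := by
      ext i j
      simp [rootedLaplacian, outflux, Matrix.one_apply]
    have hf (x : X) : (outflux (fun _ _ : X => 0) x + (if x = xN then 1 else 0) - 1).factorial
        = 1 := by
      simp only [outflux, sum_const_zero, zero_add]
      split_ifs <;> rfl
    rw [hM, pathCount_zero]
    simp [hf]
  | succ N ih =>
    intro x₀ φ hG hN hb
    have hloop (x : X) : φ x x = 0 := by
      by_contra h
      exact G.irrefl (hG x x h)
    obtain ⟨z, hz⟩ : ∃ z, outflux φ z ≠ 0 := by
      by_contra! h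
      rw [sum_comm] at hN
      have : ∑ z, outflux φ z = 0 := sum_eq_zero fun z _ => h z
      unfold outflux at this
      omega
    rw [det_mul_prod_factorial_eq_sum hloop hb hz, pathCount_succ G N x₀ φ hG, sum_mul]
    push_cast
    refine sum_congr rfl fun y _ => ?_
    by_cases hy : φ y x₀ = 0
    · simp [hy]
    · have hG' (a b : X) (h : removeArrow φ y x₀ a b ≠ 0) : G.Adj a b := by
        refine hG a b ?_
        have := removeArrow_add hy a b
        omega
      have hN' : ∑ a, ∑ b, removeArrow φ y x₀ a b = N := by
        have := sum_removeArrow_add_one hy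
        omega
      have := ih y (removeArrow φ y x₀) hG' hN' (hb.removeArrow hy)
      push_cast at this
      have hw : ((∏ a, ∏ b, (φ a b).factorial : ℕ) : ℤ) =
          (φ y x₀ * ∏ a, ∏ b, (removeArrow φ y x₀ a b).factorial : ℕ) :=
        congrArg _ (prod_factorial_removeArrow hy)
      push_cast at hw
      rw [← this, if_neg hy, hw]
      ring

theorem prod_factorial_visited {X : Type*} [Fintype X] [DecidableEq X] (φ : X → X → ℕ) (xN : X) :
    ∏ x : Visited φ, (outflux φ x.1 + (if x.1 = xN then 1 else 0) - 1).factorial =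
      ∏ x, (outflux φ x + (if x = xN then 1 else 0) - 1).factorial := by
  rw [← Fintype.prod_subtype_mul_prod_subtype (fun x => 0 < influx φ x + outflux φ x)]
  refine (mul_eq_left₀ (prod_ne_zero_iff.2 fun x _ => Nat.factorial_ne_zero _)).2
    (prod_eq_one fun x _ => ?_) |>.symm
  have : outflux φ x.1 = 0 := by
    have := x.2
    omega
  -- the natural subtraction truncates here, so that unvisited states contribute `0! = 1`
  rw [this, zero_add]
  split_ifs <;> rfl

end MarkovFlux

theorem mainTheorem1 {X : Type*} [Fintype X] [DecidableEq X] (G : SimpleGraph X)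
    (N : ℕ) (x₀ : X) (φ : X → X → ℕ) :
    (∀ xN : X, (∀ x y, φ x y ≠ 0 → G.Adj x y) → ∑ x, ∑ y, φ x y = N →
      MarkovFlux.IsQuasiBalanced φ x₀ xN →
        (∀ x ∈ MarkovFlux.fluxPaths G N x₀ φ, x (Fin.last N) = xN) ∧
        (MarkovFlux.pathCount G N x₀ φ : ℚ) =
          (MarkovFlux.tourCount φ N x₀ xN : ℚ) /
            ((∏ x, ∏ y, Nat.factorial (φ x y) : ℕ) : ℚ) ∧
        (MarkovFlux.pathCount G N x₀ φ : ℚ) =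
          ((MarkovFlux.reducedLaplacian φ xN).det : ℚ) *
            (((∏ x : MarkovFlux.Visited φ,
              Nat.factorial (MarkovFlux.outflux φ x.1 + (if x.1 = xN then 1 else 0) - 1) : ℕ) : ℚ) /
            ((∏ x, ∏ y, Nat.factorial (φ x y) : ℕ) : ℚ))) ∧
    (∀ π : X → X → ℝ, MarkovFlux.IsRestlessChain G π →
      MarkovFlux.fluxProb G π N x₀ φ =
        (MarkovFlux.pathCount G N x₀ φ : ℝ) * ∏ x, ∏ y, π x y ^ φ x y ∧
      MarkovFlux.fluxProb G π N x₀ φ =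
        (MarkovFlux.pathCount G N x₀ φ : ℝ) *
          Real.exp (∑ x, ∑ y, (φ x y : ℝ) * Real.log (π x y))) := by
  refine ⟨fun xN hG hN hb => ?_, fun π hπ => ⟨MarkovFlux.fluxProb_eq G π N x₀ φ,
    MarkovFlux.fluxProb_eq_exp hπ N x₀ φ⟩⟩
  have hpos : ((∏ x, ∏ y, Nat.factorial (φ x y) : ℕ) : ℚ) ≠ 0 :=
    Nat.cast_ne_zero.2 (prod_ne_zero_iff.2 fun x _ => prod_ne_zero_iff.2 fun y _ =>
      Nat.factorial_ne_zero _)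
  refine ⟨fun x hx => MarkovFlux.last_eq_of_mem_fluxPaths hb hx, ?_, ?_⟩
  · rw [eq_div_iff hpos, MarkovFlux.tourCount_eq G N x₀ xN φ hG hb, Nat.cast_mul]
  · rw [← mul_div_assoc, eq_div_iff hpos, MarkovFlux.prod_factorial_visited,
      MarkovFlux.det_reducedLaplacian hb]
    exact_mod_cast MarkovFlux.pathCount_mul_prod_factorial G N xN x₀ φ hG hN hb
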